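/- Let $r, p, n, e, m$ be positive integers with $p \mid r$ and $e \mid p$. Let $G(r,p,n) \subset GL_n(\mathbb{C})$ be the group of all $n \times n$ monomial matrices (exactly one non-zero entry in each row and column) whose non-zero entries are complex $r$-th roots of unity such that the product of the non-zero entries is an $\frac{r}{p}$-th root of unity. Let $\xi_{er/p}$ be a primitive $\frac{er}{p}$-th root of unity in $\mathbb{C}$, let $\gamma = \mathrm{diag}(\xi_{er/p}, 1, \ldots, 1) \in GL_n(\mathbb{C})$, and let $\gamma G(r,p,n) = \{\gamma g \mid g \in G(r,p,n)\}$. Let $\zeta \in \mathbb{C}$ be a primitive $m$-th root of unity, and for $x \in GL_n(\mathbb{C})$ write $V(x,\zeta) = \{v \in \mathbb{C}^n \mid xv = \zeta v\}$. Then for all $x, y \in \gamma G(r,p,n)$ there exists $z \in \gamma G(r,p,n)$ such that $V(x,\zeta) \cap V(y,\zeta) = V(z,\zeta)$. -/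

import Mathlib

open scoped Pointwise

noncomputable section

/-- The monomial linear transformation `(θ ; σ)` of `ℂ^n`, sending the basis vector `e_j` to
`θ_{σ(j)} e_{σ(j)}`; it is invertible because the entries `θ_i` are units. -/
def monomialGL {n : ℕ} (θ : Fin n → ℂˣ) (σ : Equiv.Perm (Fin n)) : GL (Fin n) ℂ where
  val := Matrix.of fun i j => if i = σ j then (θ i : ℂ) else 0
  inv := Matrix.of fun i j => if σ i = j then (((θ j)⁻¹ : ℂˣ) : ℂ) else 0
  val_inv := by
    ext i j
    rw [Matrix.mul_apply, Finset.sum_eq_single (σ.symm i)]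
    · by_cases h : i = j <;> simp [h, Matrix.one_apply]
    · intro b _ hb
      have : i ≠ σ b := fun h => hb (by simp [h])
      simp [this]
    · simp
  inv_val := by
    ext i j
    rw [Matrix.mul_apply, Finset.sum_eq_single (σ i)]
    · by_cases h : i = j <;> simp [h, Matrix.one_apply]
    · intro b _ hb
      simp [Ne.symm hb]
    · simp

theorem monomialGL_mul {n : ℕ} (θ θ' : Fin n → ℂˣ) (σ σ' : Equiv.Perm (Fin n)) :
    monomialGL θ σ * monomialGL θ' σ' =
      monomialGL (fun i => θ i * θ' (σ.symm i)) (σ * σ') := by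
  apply Units.ext
  ext i j
  change ((monomialGL θ σ).val * (monomialGL θ' σ').val) i j = _
  rw [Matrix.mul_apply, Finset.sum_eq_single (σ.symm i)]
  · by_cases h : i = σ (σ' j) <;> simp [monomialGL, Equiv.symm_apply_eq, h]
  · intro b _ hb
    have : i ≠ σ b := fun h => hb (by simp [h])
    simp [monomialGL, this]
  · simp

theorem monomialGL_one {n : ℕ} :
    monomialGL (fun _ : Fin n => (1 : ℂˣ)) 1 = 1 := by
  apply Units.ext
  ext i j
  by_cases h : i = j <;> simp [monomialGL, h]

/-- The group `G(r,p,n)`: the invertible `n × n` monomial matrices whose non-zero entries `θ_i`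
are complex `r`-th roots of unity with `(θ_1 ⋯ θ_n)^(r/p) = 1`. -/
def imprimitiveGroup (r p n : ℕ) : Subgroup (GL (Fin n) ℂ) where
  carrier := {g | ∃ (θ : Fin n → ℂˣ) (σ : Equiv.Perm (Fin n)),
    (∀ i, θ i ^ r = 1) ∧ (∏ i, θ i) ^ (r / p) = 1 ∧ g = monomialGL θ σ}
  one_mem' := ⟨fun _ => 1, 1, by simp, by simp, monomialGL_one.symm⟩
  mul_mem' := by
    rintro _ _ ⟨θ, σ, h1, h2, rfl⟩ ⟨θ', σ', h1', h2', rfl⟩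
    refine ⟨_, _, ?_, ?_, monomialGL_mul θ θ' σ σ'⟩
    · intro i
      simp [mul_pow, h1, h1']
    · rw [Finset.prod_mul_distrib, Equiv.prod_comp σ.symm θ', mul_pow, h2, h2', one_mul]
  inv_mem' := by
    rintro _ ⟨θ, σ, h1, h2, rfl⟩
    refine ⟨fun i => (θ (σ i))⁻¹, σ⁻¹, ?_, ?_, ?_⟩
    · intro i
      simp [h1]
    · rw [Finset.prod_inv_distrib, Equiv.prod_comp σ θ, inv_pow, h2, inv_one]
    · rw [inv_eq_iff_mul_eq_one, monomialGL_mul]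
      simpa using monomialGL_one

/-- The diagonal transformation `diag(ξ, 1, …, 1)` of `ℂ^n`, for `n ≥ 1`. -/
def diagFirst (n : ℕ) [NeZero n] (ξ : ℂˣ) : GL (Fin n) ℂ where
  val := Matrix.diagonal fun i => if i = 0 then (ξ : ℂ) else 1
  inv := Matrix.diagonal fun i => if i = 0 then ((ξ⁻¹ : ℂˣ) : ℂ) else 1
  val_inv := by
    rw [Matrix.diagonal_mul_diagonal, ← Matrix.diagonal_one]
    congr 1
    funext i
    by_cases h : i = 0 <;> simp [h]
  inv_val := by
    rw [Matrix.diagonal_mul_diagonal, ← Matrix.diagonal_one]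
    congr 1
    funext i
    by_cases h : i = 0 <;> simp [h]

/-- The eigenspace `V(x, ζ) = {v ∈ V | x v = ζ v}` in `V = ℂ^n`. -/
def eigenV {n : ℕ} (x : GL (Fin n) ℂ) (ζ : ℂ) : Submodule ℂ (Fin n → ℂ) :=
  Module.End.eigenspace (Matrix.toLin' (x : Matrix (Fin n) (Fin n) ℂ)) ζ

end

open Matrix

/-! Put `W = V(x,ζ) ∩ V(y,ζ)` and pick `z` in the coset with `V(z,ζ) ⊇ W` minimal. If a reflection
`s` of `G(r,p,n)` fixes `W` pointwise but not `V(z,ζ)`, then `V(zs,ζ)` still contains `W` and is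
strictly smaller, since `z` is unitary (`eigenV_mul_reflection`). So all such `s` fix `V(z,ζ)`
pointwise. By `fixed_of_reflections`, so do `z⁻¹x` and `z⁻¹y`, which fix `W`; hence `V(z,ζ) ⊆ W`. -/

theorem monomialGL_mulVec {n : ℕ} (θ : Fin n → ℂˣ) (σ : Equiv.Perm (Fin n)) (v : Fin n → ℂ)
    (i : Fin n) :
    ((monomialGL θ σ : GL (Fin n) ℂ) : Matrix (Fin n) (Fin n) ℂ).mulVec v i =
      θ i * v (σ.symm i) := by
  rw [Matrix.mulVec, dotProduct, Finset.sum_eq_single (σ.symm i)]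
  · simp [monomialGL]
  · intro b _ hb
    have : i ≠ σ b := fun h => hb (by simp [h])
    simp [monomialGL, this]
  · simp

theorem mem_eigenV {n : ℕ} {x : GL (Fin n) ℂ} {ζ : ℂ} {v : Fin n → ℂ} :
    v ∈ eigenV x ζ ↔ (x : Matrix (Fin n) (Fin n) ℂ) *ᵥ v = ζ • v := by
  simp [eigenV]

theorem conj_mul_self_of_pow_eq_one {t : ℂ} {k : ℕ} (hk : k ≠ 0) (h : t ^ k = 1) :
    star t * t = 1 := by
  have hn : ‖t‖ = 1 := Complex.norm_eq_one_of_pow_eq_one h hk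
  simpa [hn] using Complex.conj_mul' t

/-- The invariance of the standard Hermitian form under an invertible matrix. -/
def PreservesDot {n : ℕ} (z : GL (Fin n) ℂ) : Prop :=
  ∀ u v : Fin n → ℂ, star ((z : Matrix (Fin n) (Fin n) ℂ) *ᵥ u) ⬝ᵥ
    ((z : Matrix (Fin n) (Fin n) ℂ) *ᵥ v) = star u ⬝ᵥ v

theorem PreservesDot.mul {n : ℕ} {z w : GL (Fin n) ℂ} (hz : PreservesDot z)
    (hw : PreservesDot w) : PreservesDot (z * w) := by
  intro u v
  rw [Units.val_mul, ← mulVec_mulVec, ← mulVec_mulVec, hz, hw]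

theorem preservesDot_of_mem_imprimitiveGroup {n r p : ℕ} (hr : r ≠ 0) {g : GL (Fin n) ℂ}
    (hg : g ∈ imprimitiveGroup r p n) : PreservesDot g := by
  obtain ⟨θ, σ, h1, -, rfl⟩ := hg
  intro u v
  simp only [dotProduct, Pi.star_apply, monomialGL_mulVec]
  rw [← Equiv.sum_comp σ.symm (fun i => star (u i) * v i)]
  refine Finset.sum_congr rfl fun i _ => ?_
  have h := conj_mul_self_of_pow_eq_one hr (t := θ i) (by rw [← Units.val_pow_eq_pow_val, h1 i, Units.val_one])
  rw [star_mul]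
  linear_combination (star (u (σ.symm i)) * v (σ.symm i)) * h

theorem diagFirst_preservesDot {n : ℕ} [NeZero n] {ξ : ℂˣ} (hξ : star (ξ : ℂ) * ξ = 1) :
    PreservesDot (diagFirst n ξ) := by
  intro u v
  simp only [dotProduct, Pi.star_apply, diagFirst, mulVec_diagonal]
  refine Finset.sum_congr rfl fun i _ => ?_
  split_ifs
  · rw [star_mul]
    linear_combination (star (u i) * v i) * hξ
  · simp

/-- If `z` is unitary and `s` is a reflection with root `a` that does not fix `V(z, ζ)` pointwise,
then `V(z s, ζ)` consists of the vectors of `V(z, ζ)` fixed by `s`. -/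
theorem eigenV_mul_reflection {n : ℕ} {z s : GL (Fin n) ℂ} {ζ : ℂ} (hz : PreservesDot z)
    (hζ : star ζ * ζ = 1) {a : Fin n → ℂ} {k : ℂ}
    (hs : ∀ v, (s : Matrix (Fin n) (Fin n) ℂ) *ᵥ v = v + (k * (star a ⬝ᵥ v)) • a)
    {v : Fin n → ℂ} (hv : v ∈ eigenV z ζ) (hsv : (s : Matrix (Fin n) (Fin n) ℂ) *ᵥ v ≠ v)
    {u : Fin n → ℂ} (hu : u ∈ eigenV (z * s) ζ) :
    (s : Matrix (Fin n) (Fin n) ℂ) *ᵥ u = u ∧ u ∈ eigenV z ζ := by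
  rw [mem_eigenV] at hv hu
  rw [Units.val_mul, ← mulVec_mulVec] at hu
  have hav : star v ⬝ᵥ a ≠ 0 := by
    intro h
    apply hsv
    have : star a ⬝ᵥ v = 0 := by
      rw [← star_star (star a ⬝ᵥ v), star_dotProduct, star_star, h, star_zero]
    rw [hs, this]
    simp
  -- As `zv = ζv`, `zsu = ζu` and `|ζ| = 1`, unitarity gives `⟨v, u⟩ = ⟨v, su⟩`. Since `su - u` is a
  -- multiple of `a` and `⟨v, a⟩ ≠ 0`, that multiple is zero.
  have hdot := hz v ((s : Matrix (Fin n) (Fin n) ℂ) *ᵥ u)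
  rw [hv, hu, hs] at hdot
  simp only [star_smul, smul_dotProduct, dotProduct_smul, dotProduct_add, smul_eq_mul] at hdot
  have hc : k * (star a ⬝ᵥ u) = 0 := by
    have : k * (star a ⬝ᵥ u) * (star v ⬝ᵥ a) = 0 := by
      linear_combination (star v ⬝ᵥ u) * hζ - hdot
    exact (mul_eq_zero.mp this).resolve_right hav
  have hsu : (s : Matrix (Fin n) (Fin n) ℂ) *ᵥ u = u := by rw [hs, hc]; simp
  exact ⟨hsu, by rw [mem_eigenV]; rwa [hsu] at hu⟩

/-- A vector satisfying all the equations imposed by the reflections of `G(r,p,n)` that fix `W`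
pointwise is fixed by each element of `G(r,p,n)` fixing `W` pointwise. -/
theorem fixed_of_reflections {n r p : ℕ}
    {W : Submodule ℂ (Fin n → ℂ)} {v : Fin n → ℂ}
    (hswap : ∀ i j, i ≠ j → ∀ t : ℂˣ, t ^ r = 1 → (∀ w ∈ W, w i = t * w j) → v i = t * v j)
    (hdiag : ∀ j, ∀ t : ℂˣ, t ≠ 1 → t ^ (r / p) = 1 → (∀ w ∈ W, w j = 0) → v j = 0)
    {h : GL (Fin n) ℂ} (hG : h ∈ imprimitiveGroup r p n)
    (hW : ∀ w ∈ W, (h : Matrix (Fin n) (Fin n) ℂ) *ᵥ w = w) :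
    (h : Matrix (Fin n) (Fin n) ℂ) *ᵥ v = v := by
  obtain ⟨θ, σ, h1, h2, rfl⟩ := hG
  have hW' : ∀ w ∈ W, ∀ i, w i = θ i * w (σ.symm i) := fun w hw i => by
    rw [← monomialGL_mulVec, hW w hw]
  ext i
  rw [monomialGL_mulVec]
  by_cases hi : σ.symm i = i
  · rw [hi]
    by_cases ht : θ i = 1
    · simp [ht]
    have hi0 : ∀ w ∈ W, w i = 0 := by
      intro w hw
      have := hW' w hw i
      rw [hi] at this
      have h' : ((θ i : ℂ) - 1) * w i = 0 := by linear_combination -this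
      refine (mul_eq_zero.mp h').resolve_left fun h0 => ht ?_
      exact Units.ext (by simpa using sub_eq_zero.mp h0)
    suffices v i = 0 by simp [this]
    -- A second coordinate `j` vanishing on `W` makes the swap equations available for both `t = 1`
    -- and `t = θ i ≠ 1`, forcing `v i = 0`.
    by_cases hZ : ∃ j, i ≠ j ∧ ∀ w ∈ W, w j = 0
    · obtain ⟨j, hij, hj⟩ := hZ
      have e1 := hswap i j hij 1 (one_pow _) fun w hw => by simp [hi0 w hw, hj w hw]
      have e2 := hswap i j hij (θ i) (h1 i) fun w hw => by simp [hi0 w hw, hj w hw]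
      rw [Units.val_one, one_mul] at e1
      have h' : ((θ i : ℂ) - 1) * v i = 0 := by linear_combination -e2 + (θ i : ℂ) * e1
      refine (mul_eq_zero.mp h').resolve_left fun h0 => ht ?_
      exact Units.ext (by simpa using sub_eq_zero.mp h0)
    · push Not at hZ
      refine hdiag i (θ i) ht ?_ hi0
      suffices hprod : ∏ j ∈ Finset.univ.erase i, θ j = 1 by
        rwa [← Finset.mul_prod_erase _ _ (Finset.mem_univ i), hprod, mul_one] at h2
      -- A vector space over an infinite field is not a finite union of proper subspaces.
      -- Multiplying `w j = θ j * w (σ.symm j)` over `j ≠ i` and cancelling gives the product.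
      obtain ⟨w, hw, hw0⟩ : ∃ w ∈ W, ∀ j ∈ Finset.univ.erase i, w j ≠ 0 := by
        obtain ⟨w, hw, hw0⟩ := Module.Dual.exists_forall_mem_ne_zero_of_forall_exists W
          (fun j : {j // i ≠ j} => LinearMap.proj (R := ℂ) (φ := fun _ : Fin n => ℂ) j.1)
          fun j => hZ j.1 j.2
        exact ⟨w, hw, fun j hj => hw0 ⟨j, (Finset.ne_of_mem_erase hj).symm⟩⟩
      have hperm : ∏ j ∈ Finset.univ.erase i, w (σ.symm j) = ∏ j ∈ Finset.univ.erase i, w j := by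
        refine Finset.prod_equiv σ.symm (fun j => ?_) fun _ _ => rfl
        simp only [Finset.mem_erase, Finset.mem_univ, and_true, ne_eq]
        rw [← σ.symm.injective.eq_iff (a := j) (b := i), hi]
      have hcalc : ∏ j ∈ Finset.univ.erase i, w j =
          (∏ j ∈ Finset.univ.erase i, (θ j : ℂ)) * ∏ j ∈ Finset.univ.erase i, w j := by
        conv_lhs => rw [Finset.prod_congr rfl fun j _ => hW' w hw j]
        rw [Finset.prod_mul_distrib, hperm]
      have hne := Finset.prod_ne_zero_iff.mpr hw0
      apply Units.ext
      rw [Units.coe_prod, Units.val_one]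
      exact mul_right_cancel₀ hne (by rw [← hcalc, one_mul])
  · exact (hswap i (σ.symm i) (Ne.symm hi) (θ i) (h1 i) fun w hw => hW' w hw i).symm

/-- This exhibits a reflection of order 2 with root `e_i - t̄ e_j` and hyperplane `v i = t * v j`.
-/
theorem monomialGL_swap_mulVec {n : ℕ} {i j : Fin n} (hij : i ≠ j) {t : ℂˣ}
    (ht : star (t : ℂ) * t = 1) (v : Fin n → ℂ) :
    ((monomialGL (Pi.mulSingle i t * Pi.mulSingle j t⁻¹) (Equiv.swap i j) : GL (Fin n) ℂ) :
      Matrix (Fin n) (Fin n) ℂ) *ᵥ v =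
      v + ((-1 : ℂ) * (star (Pi.single i 1 - Pi.single j (star (t : ℂ))) ⬝ᵥ v)) •
        (Pi.single i 1 - Pi.single j (star (t : ℂ)) : Fin n → ℂ) := by
  have hti : ((t⁻¹ : ℂˣ) : ℂ) = star (t : ℂ) := by
    rw [Units.val_inv_eq_inv_val]
    exact (eq_inv_of_mul_eq_one_left ht).symm
  ext k
  rw [monomialGL_mulVec, star_sub, sub_dotProduct, Pi.star_single, Pi.star_single,
    single_dotProduct, single_dotProduct, star_one, star_star]
  rw [Equiv.symm_swap]
  rcases eq_or_ne k i with rfl | hki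
  · simp [hij]
  rcases eq_or_ne k j with rfl | hkj
  · simp only [RCLike.star_def] at ht hti ⊢
    simp [hki, hti]
    linear_combination v k * ht
  · simp [hki, hkj, Equiv.swap_apply_of_ne_of_ne hki hkj]

theorem monomialGL_swap_mem {n r p : ℕ} {i j : Fin n} {t : ℂˣ} (ht : t ^ r = 1) :
    monomialGL (Pi.mulSingle i t * Pi.mulSingle j t⁻¹) (Equiv.swap i j) ∈
      imprimitiveGroup r p n := by
  refine ⟨_, _, fun k => ?_, ?_, rfl⟩
  · simp only [Pi.mul_apply, Pi.mulSingle_apply, mul_pow]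
    split_ifs <;> simp [ht]
  · simp [Finset.prod_mul_distrib]

theorem monomialGL_mulSingle_mulVec {n : ℕ} (j : Fin n) (t : ℂˣ) (v : Fin n → ℂ) :
    ((monomialGL (Pi.mulSingle j t) 1 : GL (Fin n) ℂ) : Matrix (Fin n) (Fin n) ℂ) *ᵥ v =
      v + (((t : ℂ) - 1) * (star (Pi.single j 1) ⬝ᵥ v)) • (Pi.single j 1 : Fin n → ℂ) := by
  ext k
  rw [monomialGL_mulVec, Pi.star_single, single_dotProduct, star_one]
  have h1 : Equiv.symm (1 : Equiv.Perm (Fin n)) = 1 := rfl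
  rw [h1]
  rcases eq_or_ne k j with rfl | hkj
  · simp
    ring
  · simp [hkj]

theorem monomialGL_mulSingle_mem {n r p : ℕ} (hp : p ∣ r) {j : Fin n} {t : ℂˣ}
    (ht : t ^ (r / p) = 1) :
    monomialGL (Pi.mulSingle j t) 1 ∈ imprimitiveGroup r p n := by
  refine ⟨_, _, fun k => ?_, ?_, rfl⟩
  · simp only [Pi.mulSingle_apply]
    split_ifs
    · rw [← Nat.div_mul_cancel hp, pow_mul, ht, one_pow]
    · simp
  · simp [ht]

theorem mainTheorem11 (r p n e m : ℕ) [NeZero n] (hr : 0 < r) (hp : p ∣ r) (he : e ∣ p)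
    (ξ : ℂˣ) (hξ : IsPrimitiveRoot (ξ : ℂ) (e * r / p))
    (ζ : ℂ) (hm : 0 < m) (hζ : IsPrimitiveRoot ζ m)
    (x y : GL (Fin n) ℂ)
    (hx : x ∈ diagFirst n ξ • (imprimitiveGroup r p n : Set (GL (Fin n) ℂ)))
    (hy : y ∈ diagFirst n ξ • (imprimitiveGroup r p n : Set (GL (Fin n) ℂ))) :
    ∃ z ∈ diagFirst n ξ • (imprimitiveGroup r p n : Set (GL (Fin n) ℂ)),
      eigenV x ζ ⊓ eigenV y ζ = eigenV z ζ := by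
  have hp0 : 0 < p := Nat.pos_of_dvd_of_pos hp hr
  have he0 : 0 < e := Nat.pos_of_dvd_of_pos he hp0
  have hk : e * r / p ≠ 0 := by
    rw [Nat.mul_div_assoc _ hp]
    exact (Nat.mul_pos he0 (Nat.div_pos (Nat.le_of_dvd hr hp) hp0)).ne'
  have hξ1 := conj_mul_self_of_pow_eq_one hk hξ.pow_eq_one
  have hζ1 := conj_mul_self_of_pow_eq_one hm.ne' hζ.pow_eq_one
  set C := diagFirst n ξ • (imprimitiveGroup r p n : Set (GL (Fin n) ℂ)) with hC
  set W := eigenV x ζ ⊓ eigenV y ζ with hWdef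
  have hunit : ∀ z ∈ C, PreservesDot z := by
    rintro _ ⟨g, hg, rfl⟩
    exact (diagFirst_preservesDot hξ1).mul (preservesDot_of_mem_imprimitiveGroup hr.ne' hg)
  have hCG : ∀ z ∈ C, ∀ g ∈ imprimitiveGroup r p n, z * g ∈ C := by
    rintro _ ⟨g, hg, rfl⟩ g' hg'
    exact ⟨g * g', mul_mem hg hg', by simp [mul_assoc]⟩
  have hquot : ∀ z ∈ C, ∀ z' ∈ C, z⁻¹ * z' ∈ imprimitiveGroup r p n := by
    rintro _ ⟨g, hg, rfl⟩ _ ⟨g', hg', rfl⟩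
    simpa [mul_assoc] using mul_mem (inv_mem hg) hg'
  obtain ⟨_, ⟨z, hz, hWz, rfl⟩, hmin⟩ := wellFounded_lt.has_min
    {E : Submodule ℂ (Fin n → ℂ) | ∃ z ∈ C, W ≤ eigenV z ζ ∧ eigenV z ζ = E}
    ⟨_, x, hx, inf_le_left, rfl⟩
  have hrefl : ∀ s ∈ imprimitiveGroup r p n, ∀ (a : Fin n → ℂ) (k : ℂ),
      (∀ v, (s : Matrix (Fin n) (Fin n) ℂ) *ᵥ v = v + (k * (star a ⬝ᵥ v)) • a) →
      (∀ w ∈ W, (s : Matrix (Fin n) (Fin n) ℂ) *ᵥ w = w) →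
      ∀ v ∈ eigenV z ζ, (s : Matrix (Fin n) (Fin n) ℂ) *ᵥ v = v := by
    intro s hsG a k hs hsW v hv
    by_contra hsv
    -- The inclusion `V(zs,ζ) ≤ V(z,ζ)` is strict because `v` lies only in the larger space,
    -- contradicting minimality.
    have hle := fun u => eigenV_mul_reflection (u := u) (hunit z hz) hζ1 hs hv hsv
    refine hmin _ ⟨z * s, hCG z hz s hsG, fun w hw => ?_, rfl⟩
      (lt_of_le_of_ne (fun u hu => (hle u hu).2) fun heq => hsv (hle v (heq ▸ hv)).1)
    rw [mem_eigenV, Units.val_mul, ← mulVec_mulVec, hsW w hw]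
    exact mem_eigenV.mp (hWz hw)
  have key : ∀ x' ∈ C, W ≤ eigenV x' ζ → eigenV z ζ ≤ eigenV x' ζ := by
    intro x' hx' hWx' v hv
    have hfix : ((z⁻¹ * x' : GL (Fin n) ℂ) : Matrix (Fin n) (Fin n) ℂ) *ᵥ v = v := by
      refine fixed_of_reflections (W := W) (fun i j hij t ht hw => ?_)
        (fun j t ht1 ht hw => ?_) (hquot z hz x' hx') fun w hw => ?_
      · have ht1 := conj_mul_self_of_pow_eq_one hr.ne' (t := t) (by rw [← Units.val_pow_eq_pow_val, ht, Units.val_one])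
        have hs := monomialGL_swap_mulVec hij ht1
        have := congrFun (hrefl _ (monomialGL_swap_mem ht) _ _ hs (fun w hwW => by
          rw [hs, star_sub, sub_dotProduct, Pi.star_single, Pi.star_single,
            single_dotProduct, single_dotProduct, star_one, star_star, hw w hwW]
          simp) v hv) i
        rw [monomialGL_mulVec] at this
        simpa [hij] using this.symm
      · have hs := monomialGL_mulSingle_mulVec j t
        have := congrFun (hrefl _ (monomialGL_mulSingle_mem hp ht) _ _ hs (fun w hwW => by
          rw [hs, Pi.star_single, single_dotProduct, hw w hwW]
          simp) v hv) j
        rw [hs, Pi.star_single, single_dotProduct] at this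
        have ht' : (t : ℂ) ≠ 1 := fun h => ht1 (Units.ext h)
        simpa [ht', sub_eq_zero] using this
      · have h1 := mem_eigenV.mp (hWx' hw)
        rw [Units.val_mul, ← mulVec_mulVec, h1, ← mem_eigenV.mp (hWz hw), mulVec_mulVec,
          ← Units.val_mul, inv_mul_cancel, Units.val_one, one_mulVec]
    have : x' = z * (z⁻¹ * x') := by group
    rw [mem_eigenV, this, Units.val_mul, ← mulVec_mulVec, hfix]
    exact mem_eigenV.mp hv
  exact ⟨z, hz, le_antisymm hWz (le_inf (key x hx inf_le_left) (key y hy inf_le_right))⟩
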